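/- **The game.** Let $n\ge 3$, let $V=[n]\times\{0,1,01,11\}$, and let indices be added and subtracted modulo $n$. Let $x,y\in\{0,1\}^n$ be strings for which there is exactly one index $i$ with $x_i>y_i$. Let $G_A$ be the directed graph on $V$ with the edges - $(i,1)\to(i+1,z)$ for all $i$, where $z=0$ if $x_{i+1}=0$ and $z=11$ otherwise; - $(i,0)\to(i+1,z)$ for all $i$ with $x_i=0$, where $z=0$ if $x_{i+1}=0$ and $z=01$ otherwise; - $(i,0)\to(i-1,x_{i-1})$ for all $i$ with $x_i=1$; - $(i,01)\to(i,1)$ and $(i,11)\to(i,1)$ for all $i$. Let $G_B$ be the directed graph on $V$ with the edges - $(i,1)\to(i+1,z)$ for all $i$, where $z=0$ if $y_{i+1}=0$ and $z=11$ otherwise; - $(i,0)\to(i+1,z)$ for all $i$, where $z=0$ if $y_{i+1}=0$ and $z=01$ otherwise; - $(i,01)\to(i,1)$ and $(i,11)\to(i,1)$ for all $i$. In the *2-cycle $N\times N$ game* ($N=4n$) both players $A$ and $B$ have the action set $V$; $u_A(u,v)=1$ if $v\to u$ is an edge of $G_A$ and $u_A(u,v)=0$ otherwise; $u_B(u,v)=1$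 if $u\to v$ is an edge of $G_B$ and $u_B(u,v)=0$ otherwise. **The task.** For $\varepsilon\in[0,1)$, an *$\varepsilon$-approximate correlated equilibrium* is a probability distribution $\mu$ on $V\times V$ such that $\sum_{v}\mu(u,v)\,(u_A(u',v)-u_A(u,v))\le\varepsilon$ for all $u,u'\in V$ and $\sum_{u}\mu(u,v)\,(u_B(u,v')-u_B(u,v))\le\varepsilon$ for all $v,v'\in V$. Player $A$ gets $u_A$ and player $B$ gets $u_B$, and $\varepsilon$ and $V$ are known to both; after exchanging bits according to a two-player protocol with common and private random coins, both players have to output the same $\varepsilon$-approximate correlated equilibrium $\mu$ of the game. The protocol has *error probability at most $1/3$* if for every 2-cycle $N\times N$ game it fails with probability at most $1/3$. Its *communication complexity* is the largest total number of bits exchanged, over all 2-cycle $N\times N$ games and all outcomes of the coins. **Theorem.** There are absolute constants $c>0$ and $N_0$ such that for every $N=4n\ge N_0$ with $n\ge3$ and every $0\le\varepsilon\le\frac1{24N^3}$, every randomized communication protocol that finds an $\varepsilon$-approximate correlated equilibrium of the 2-cycle $N\times N$ game with error probability at most $\frac13$ has communication complexity at least $cN$. -/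

import Mathlib

open MeasureTheory
open scoped ENNReal

/-! Two-party communication protocols -/

/-- A two-party protocol tree. Player A holds an element of `X`, player B an element of `Y`.
At an inner node one of the players sends one bit, computed from that player's own input
(and from the bits exchanged so far, that is, from the node); at a leaf each player
produces an output from that player's own input (and the transcript). -/
inductive Protocol (X : Type*) (Y : Type*) (O : Type*) where
  | output (a : X → O) (b : Y → O) : Protocol X Y O
  | sendA (bit : X → Bool) (next : Bool → Protocol X Y O) : Protocol X Y O
  | sendB (bit : Y → Bool) (next : Bool → Protocol X Y O) : Protocol X Y O

namespace Protocol

variable {X Y O : Type*}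

/-- The outputs of the two players on inputs `x`, `y`. -/
def run : Protocol X Y O → X → Y → O × O
  | output a b, x, y => (a x, b y)
  | sendA bit next, x, y => (next (bit x)).run x y
  | sendB bit next, x, y => (next (bit y)).run x y

/-- The number of bits exchanged on inputs `x`, `y`. -/
def bits : Protocol X Y O → X → Y → ℕ
  | output _ _, _, _ => 0
  | sendA bit next, x, y => (next (bit x)).bits x y + 1
  | sendB bit next, x, y => (next (bit y)).bits x y + 1

end Protocol

/-- A two-party search task: the input pairs that can occur, and the outputs that are
correct for a given input pair. -/
structure CommTask (X : Type*) (Y : Type*) (O : Type*) where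
  promise : X → Y → Prop
  valid : X → Y → O → Prop

universe u

/-- A randomized protocol with common coins (drawn from `R`) and private coins of the players
(drawn from `RA` and `RB`). The coins are independent and may come from arbitrary probability
spaces. The tree may depend on the common coins, and each message and each output on
everything that the player in question knows. -/
structure RandProtocol (X : Type*) (Y : Type*) (O : Type*) where
  R : Type u
  RA : Type u
  RB : Type u
  [measR : MeasurableSpace R]
  [measRA : MeasurableSpace RA]
  [measRB : MeasurableSpace RB]
  common : Measure R
  privateA : Measure RA
  privateB : Measure RB
  [probR : IsProbabilityMeasure common]
  [probRA : IsProbabilityMeasure privateA]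
  [probRB : IsProbabilityMeasure privateB]
  tree : R → Protocol (RA × X) (RB × Y) O

namespace RandProtocol

attribute [instance] measR measRA measRB probR probRA probRB

variable {X Y O : Type*}

/-- The joint law of all the coins. -/
noncomputable def coins (P : RandProtocol X Y O) : Measure (P.R × P.RA × P.RB) :=
  P.common.prod (P.privateA.prod P.privateB)

/-- On inputs `x`, `y` and coins `ω`, both players end up with the same, correct output. -/
def Succeeds (P : RandProtocol X Y O) (T : CommTask X Y O) (x : X) (y : Y)
    (ω : P.R × P.RA × P.RB) : Prop :=
  ∃ o : O, (P.tree ω.1).run (ω.2.1, x) (ω.2.2, y) = (o, o) ∧ T.valid x y o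

/-- `P` solves `T` with error probability at most `δ`: on every input pair that can occur,
the failure event has probability at most `δ` (outer probability, should it fail to be
measurable). -/
def SolvesWithError (P : RandProtocol X Y O) (T : CommTask X Y O) (δ : ℝ≥0∞) : Prop :=
  ∀ x y, T.promise x y → P.coins {ω | ¬ P.Succeeds T x y ω} ≤ δ

/-- The communication complexity of `P` on `T`: the worst-case number of bits exchanged, over
all input pairs that can occur and all outcomes of the coins. -/
noncomputable def cost (P : RandProtocol X Y O) (T : CommTask X Y O) : ℕ∞ :=
  ⨆ (x : X) (y : Y) (_ : T.promise x y) (ω : P.R × P.RA × P.RB),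
    (((P.tree ω.1).bits (ω.2.1, x) (ω.2.2, y) : ℕ) : ℕ∞)

end RandProtocol

/-! Approximate correlated equilibria -/

/-- `μ` is an `ε`-approximate correlated equilibrium of the two-player game with action sets
`U`, `V` and utility functions `uA`, `uB`. -/
def IsApproxCorrelatedEq {U V : Type*} [Fintype U] [Fintype V] (uA uB : U → V → ℝ) (ε : ℝ)
    (μ : U × V → ℝ) : Prop :=
  μ ∈ stdSimplex ℝ (U × V) ∧
  (∀ u u' : U, ∑ v, μ (u, v) * (uA u' v - uA u v) ≤ ε) ∧
  (∀ v v' : V, ∑ u, μ (u, v) * (uB u v' - uB u v) ≤ ε)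

/-! The 2-cycle game -/

/-- The four labels `0`, `1`, `01`, `11`. -/
inductive Label where
  | l0
  | l1
  | l01
  | l11
  deriving DecidableEq

instance : Fintype Label where
  elems := {.l0, .l1, .l01, .l11}
  complete := by intro z; cases z <;> decide

/-- The vertex set `[n] × {0, 1, 01, 11}`; indices are added and subtracted modulo `n`. -/
abbrev Vertex (n : ℕ) := Fin n × Label

/-- The edges of player A's graph; the pair `(v, w)` is an edge from `v` into `w`. -/
def edgesA {n : ℕ} [NeZero n] (x : Fin n → Bool) : Set (Vertex n × Vertex n) :=
  {e | ∃ i, e = ((i, .l1), (i + 1, if x (i + 1) = false then .l0 else .l11))} ∪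
  {e | ∃ i, x i = false ∧
    e = ((i, .l0), (i + 1, if x (i + 1) = false then .l0 else .l01))} ∪
  {e | ∃ i, x i = true ∧
    e = ((i, .l0), (i - 1, if x (i - 1) = false then .l0 else .l1))} ∪
  {e | ∃ i, e = ((i, .l01), (i, .l1)) ∨ e = ((i, .l11), (i, .l1))}

/-- The edges of player B's graph. -/
def edgesB {n : ℕ} [NeZero n] (y : Fin n → Bool) : Set (Vertex n × Vertex n) :=
  {e | ∃ i, e = ((i, .l1), (i + 1, if y (i + 1) = false then .l0 else .l11))} ∪
  {e | ∃ i, e = ((i, .l0), (i + 1, if y (i + 1) = false then .l0 else .l01))} ∪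
  {e | ∃ i, e = ((i, .l01), (i, .l1)) ∨ e = ((i, .l11), (i, .l1))}

open Classical in
/-- The utility function of player A: `1` if `(v, u)` is an edge of A's graph, else `0`. -/
noncomputable def utilityA {n : ℕ} [NeZero n] (x : Fin n → Bool) (u v : Vertex n) : ℝ :=
  if (v, u) ∈ edgesA x then 1 else 0

open Classical in
/-- The utility function of player B: `1` if `(u, v)` is an edge of B's graph, else `0`. -/
noncomputable def utilityB {n : ℕ} [NeZero n] (y : Fin n → Bool) (u v : Vertex n) : ℝ :=
  if (u, v) ∈ edgesB y then 1 else 0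

/-- `(uA, uB)` is the 2-cycle game of two `n`-bit strings `x`, `y` with exactly one index `i`
such that `x i > y i`. -/
def IsTwoCycleGame {n : ℕ} [NeZero n] (uA uB : Vertex n → Vertex n → ℝ) : Prop :=
  ∃ x y : Fin n → Bool, (∃! i, x i > y i) ∧ uA = utilityA x ∧ uB = utilityB y

/-- The task of finding an `ε`-approximate correlated equilibrium of the 2-cycle game on the
vertex set `Vertex n`: each player gets that player's own utility function, and both have to
know the same `ε`-approximate correlated equilibrium. -/
def twoCycleTask (n : ℕ) [NeZero n] (ε : ℝ) :
    CommTask (Vertex n → Vertex n → ℝ) (Vertex n → Vertex n → ℝ)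
      (Vertex n × Vertex n → ℝ) where
  promise uA uB := IsTwoCycleGame uA uB
  valid uA uB μ := IsApproxCorrelatedEq uA uB ε μ

/-- One half of a flow argument: if `b` is dominated by the inflow of `a` along `g`, and the
potential drops along every edge that does not start or end in a cut set, then the
potential-weighted sum of `b` is bounded by that of `a`, with a drop of `1`. -/
theorem sum_potential_mul_le {U V : Type*} [Fintype U] [Fintype V] [DecidableEq U] [DecidableEq V]
    (g : U → V) (a : U → ℝ) (b : V → ℝ) (φ : U → ℝ) (ψ : V → ℝ) (C : Finset U) (D : Finset V)
    {ε θ M : ℝ} (hε : 0 ≤ ε) (hM : 0 ≤ M) (ha : ∀ u, 0 ≤ a u)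
    (hb : ∀ v, b v ≤ ∑ u with g u = v, (a u + ε))
    (hφ : ∀ u, 1 ≤ φ u) (hψ0 : ∀ v, 0 ≤ ψ v) (hψ : ∀ v, ψ v ≤ M)
    (haC : ∀ u ∈ C, a u ≤ θ) (hbD : ∀ v ∈ D, b v ≤ θ) (hθ : 0 ≤ θ)
    (hdrop : ∀ u ∉ C, a u ≠ 0 → g u ∉ D → ψ (g u) ≤ φ u - 1) :
    ∑ v, ψ v * b v ≤ ∑ u, (φ u - 1) * a u + M * ((C.card + D.card) * θ + Fintype.card U * ε) := by
  have h1 : ∀ v, ψ v * b v ≤ (if v ∈ D then M * θ else 0) +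
      ∑ u with g u = v, (if v ∈ D then 0 else ψ v * (a u + ε)) := by
    intro v
    split_ifs with hv
    · simp only [Finset.sum_const_zero, add_zero]
      exact (mul_le_mul_of_nonneg_left (hbD v hv) (hψ0 v)).trans
        (mul_le_mul_of_nonneg_right (hψ v) hθ)
    · rw [← Finset.mul_sum, zero_add]
      exact mul_le_mul_of_nonneg_left (hb v) (hψ0 v)
  have h2 : ∀ u, (if g u ∈ D then 0 else ψ (g u) * (a u + ε)) ≤
      (φ u - 1) * a u + (if u ∈ C then M * θ else 0) + M * ε := by
    intro u
    have e1 := mul_nonneg (sub_nonneg.2 (hφ u)) (ha u)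
    have e2 := mul_nonneg hM hε
    have e3 := mul_nonneg hM hθ
    have e4 := mul_le_mul_of_nonneg_right (hψ (g u)) hε
    split_ifs with h h' h'
    · positivity
    · positivity
    · have e5 := mul_le_mul_of_nonneg_right (hψ (g u)) (ha u)
      have e6 := mul_le_mul_of_nonneg_left (haC u h') hM
      linarith [mul_add (ψ (g u)) (a u) ε]
    · by_cases h0 : a u = 0
      · rw [h0]
        simpa using e4
      · have := mul_le_mul_of_nonneg_right (hdrop u h' h0 h) (ha u)
        linarith [mul_add (ψ (g u)) (a u) ε]
  calc ∑ v, ψ v * b v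
      ≤ ∑ v, ((if v ∈ D then M * θ else 0) +
          ∑ u with g u = v, (if v ∈ D then 0 else ψ v * (a u + ε))) :=
        Finset.sum_le_sum fun v _ => h1 v
    _ = D.card * (M * θ) + ∑ u, (if g u ∈ D then 0 else ψ (g u) * (a u + ε)) := by
        rw [Finset.sum_add_distrib]
        congr 1
        · simp
        · rw [← Finset.sum_fiberwise Finset.univ g
            (fun u => if g u ∈ D then 0 else ψ (g u) * (a u + ε))]
          refine Finset.sum_congr rfl fun v _ => Finset.sum_congr rfl fun u hu => ?_
          rw [(Finset.mem_filter.1 hu).2]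
    _ ≤ D.card * (M * θ) +
          ∑ u, ((φ u - 1) * a u + (if u ∈ C then M * θ else 0) + M * ε) := by
        gcongr with u
        exact h2 u
    _ = _ := by
        rw [Finset.sum_add_distrib, Finset.sum_add_distrib]
        simp
        ring

/-! Games in which each player wants to be at the successor of the other player's action -/

section Successor

variable {U V : Type*} [Fintype V] [DecidableEq U]

/-- The mass of the profiles in which the second entry is mapped to the first one, restricted to
first entry `u`. -/
noncomputable def hitMass (g : V → U) (ρ : U → V → ℝ)
    (u : U) : ℝ :=
  ∑ v with g v = u, ρ u v

theorem hitMass_nonneg (g : V → U) {ρ : U → V → ℝ} (hρ : ∀ u v, 0 ≤ ρ u v) (u : U) :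
    0 ≤ hitMass g ρ u :=
  Finset.sum_nonneg fun v _ => hρ u v

theorem hitMass_le (g : V → U) {ρ : U → V → ℝ} (hρ : ∀ u v, 0 ≤ ρ u v) (u : U) :
    hitMass g ρ u ≤ ∑ v, ρ u v :=
  Finset.sum_le_sum_of_subset_of_nonneg (Finset.filter_subset _ _) fun v _ _ => hρ u v

theorem exists_of_hitMass_ne_zero {g : V → U} {ρ : U → V → ℝ} {u : U}
    (h : hitMass g ρ u ≠ 0) : ∃ v, g v = u := by
  obtain ⟨v, hv, -⟩ := Finset.exists_ne_zero_of_sum_ne_zero h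
  exact ⟨v, (Finset.mem_filter.1 hv).2⟩

/-- No deviation from `u` gains more than `ε`. -/
def NoGain (g : V → U) (ρ : U → V → ℝ) (ε : ℝ) : Prop :=
  ∀ u u', ∑ v with g v = u', ρ u v ≤ hitMass g ρ u + ε

theorem NoGain.marginal_le [Fintype U] {g : V → U} {ρ : U → V → ℝ} {ε : ℝ} (h : NoGain g ρ ε) (u : U) :
    ∑ v, ρ u v ≤ Fintype.card U * (hitMass g ρ u + ε) := by
  rw [← Finset.sum_fiberwise Finset.univ g]
  refine (Finset.sum_le_sum fun u' _ => h u u').trans_eq ?_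
  simp [mul_add]

theorem NoGain.marginal_le_of_forall_ne [Fintype U] {g : V → U} {ρ : U → V → ℝ} {ε : ℝ} (h : NoGain g ρ ε)
    {u : U} (hu : ∀ v, g v ≠ u) : ∑ v, ρ u v ≤ Fintype.card U * ε := by
  have h0 : hitMass g ρ u = 0 := by
    by_contra h'
    obtain ⟨v, hv⟩ := exists_of_hitMass_ne_zero h'
    exact hu v hv
  simpa [h0] using h.marginal_le u

theorem NoGain.hitMass_swap_le [Fintype U] [DecidableEq V] {g : V → U} {ρ : U → V → ℝ} {ε : ℝ} (h : NoGain g ρ ε)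
    (hρ : ∀ u v, 0 ≤ ρ u v) (f : U → V) (v : V) :
    hitMass f (fun v u => ρ u v) v ≤ ∑ u with f u = v, (hitMass g ρ u + ε) := by
  refine Finset.sum_le_sum fun u hu => ?_
  refine le_trans ?_ (h u (g v))
  exact Finset.single_le_sum (f := fun v => ρ u v) (fun v _ => hρ u v) (by simp)

end Successor

/-! The two graphs are graphs of functions -/

section Game

variable {n : ℕ}

/-- The number of steps left on the way from a vertex once around the cycle up to index `k`. -/
def stepsLeft (k : Fin n) : Vertex n → ℕ
  | (i, .l0) => 2 * (n - 1 - (i - k).val) + 1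
  | (i, .l1) => 2 * (n - 1 - (i - k).val) + 1
  | (i, .l01) => 2 * (n - 1 - (i - k).val) + 2
  | (i, .l11) => 2 * (n - 1 - (i - k).val) + 2

theorem one_le_stepsLeft (k : Fin n) (v : Vertex n) : 1 ≤ stepsLeft k v := by
  obtain ⟨i, l⟩ := v
  cases l <;> simp [stepsLeft]

theorem stepsLeft_le (k : Fin n) (v : Vertex n) : stepsLeft k v ≤ 2 * n := by
  obtain ⟨i, l⟩ := v
  have := (i - k).isLt
  cases l <;> simp only [stepsLeft] <;> omega

variable [NeZero n]

/-- The successor of a vertex in player A's graph. -/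
def succA (x : Fin n → Bool) : Vertex n → Vertex n
  | (i, .l1) => (i + 1, if x (i + 1) = false then .l0 else .l11)
  | (i, .l0) => if x i = false then (i + 1, if x (i + 1) = false then .l0 else .l01)
      else (i - 1, if x (i - 1) = false then .l0 else .l1)
  | (i, .l01) => (i, .l1)
  | (i, .l11) => (i, .l1)

/-- The successor of a vertex in player B's graph. -/
def succB (y : Fin n → Bool) : Vertex n → Vertex n
  | (i, .l1) => (i + 1, if y (i + 1) = false then .l0 else .l11)
  | (i, .l0) => (i + 1, if y (i + 1) = false then .l0 else .l01)
  | (i, .l01) => (i, .l1)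
  | (i, .l11) => (i, .l1)

theorem mem_edgesA_iff (x : Fin n → Bool) (v w : Vertex n) :
    (v, w) ∈ edgesA x ↔ succA x v = w := by
  obtain ⟨i, l⟩ := v
  rw [eq_comm (a := succA x (i, l))]
  cases l <;> cases h : x i <;> simp [edgesA, succA, h]

theorem mem_edgesB_iff (y : Fin n → Bool) (v w : Vertex n) :
    (v, w) ∈ edgesB y ↔ succB y v = w := by
  obtain ⟨i, l⟩ := v
  rw [eq_comm (a := succB y (i, l))]
  cases l <;> simp [edgesB, succB]

theorem IsApproxCorrelatedEq.noGain_succA {x : Fin n → Bool} {uB : Vertex n → Vertex n → ℝ}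
    {ε : ℝ} {μ : Vertex n × Vertex n → ℝ}
    (h : IsApproxCorrelatedEq (utilityA x) uB ε μ) :
    NoGain (succA x) (fun u v => μ (u, v)) ε := by
  intro u u'
  have := h.2.1 u u'
  simp only [utilityA, mem_edgesA_iff, mul_sub, Finset.sum_sub_distrib, mul_ite, mul_one,
    mul_zero, ← Finset.sum_filter] at this
  unfold hitMass
  linarith

theorem IsApproxCorrelatedEq.noGain_succB {y : Fin n → Bool} {uA : Vertex n → Vertex n → ℝ}
    {ε : ℝ} {μ : Vertex n × Vertex n → ℝ}
    (h : IsApproxCorrelatedEq uA (utilityB y) ε μ) :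
    NoGain (succB y) (fun v u => μ (u, v)) ε := by
  intro u u'
  have := h.2.2 u u'
  simp only [utilityB, mem_edgesB_iff, mul_sub, Finset.sum_sub_distrib, mul_ite, mul_one,
    mul_zero, ← Finset.sum_filter] at this
  unfold hitMass
  linarith

theorem succB_ne_l0 {y : Fin n → Bool} {i : Fin n} (hy : y i = true) (u : Vertex n) :
    succB y u ≠ (i, .l0) := by
  obtain ⟨j, l⟩ := u
  cases l <;> simp only [succB, ne_eq, Prod.mk.injEq, not_and] <;> intro h <;> simp [h, hy]

theorem succA_ne_l01 {x : Fin n → Bool} {i : Fin n} (hx : x i = false) (v : Vertex n) :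
    succA x v ≠ (i, .l01) := by
  obtain ⟨j, l⟩ := v
  cases l <;> simp only [succA, ne_eq, Prod.mk.injEq, not_and]
  case l0 =>
    split_ifs <;> simp only [Prod.mk.injEq, not_and] <;> rintro rfl <;> simp_all
  all_goals rintro rfl; simp [hx]

theorem succA_ne_l11 {x : Fin n → Bool} {i : Fin n} (hx : x i = false) (v : Vertex n) :
    succA x v ≠ (i, .l11) := by
  obtain ⟨j, l⟩ := v
  cases l <;> simp only [succA, ne_eq, Prod.mk.injEq, not_and]
  case l0 =>
    split_ifs <;> simp
  all_goals rintro rfl; simp [hx]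

theorem stepsLeft_add_one_lt {k i : Fin n} (h : i + 1 ≠ k) (l : Label) :
    stepsLeft k (i + 1, l) < 2 * (n - 1 - (i - k).val) + 1 := by
  have h1 : i + 1 - k = (i - k) + 1 := by abel
  have h2 : (i - k) + 1 ≠ 0 := by rwa [← h1, sub_ne_zero]
  have h3 : ((i - k) + 1).val = (i - k).val + 1 := by
    have h4 : ((i - k) + 1).val ≠ 0 := fun h => h2 (Fin.ext h)
    have hlt := (i - k).isLt
    rw [Fin.val_add, Fin.val_one', Nat.add_mod_mod] at h4 ⊢
    rcases Nat.lt_or_ge ((i - k).val + 1) n with h5 | h5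
    · exact Nat.mod_eq_of_lt h5
    · have : (i - k).val + 1 = n := by omega
      simp [this] at h4
  have := ((i - k) + 1).isLt
  cases l <;> simp only [stepsLeft, h1, h3] <;> omega

theorem stepsLeft_succB_lt {y : Fin n → Bool} {k : Fin n} (hy : y k = false) {u : Vertex n}
    (h : succB y u ≠ (k, .l0)) : stepsLeft k (succB y u) < stepsLeft k u := by
  obtain ⟨i, l⟩ := u
  have hk : ∀ z, (i + 1, if y (i + 1) = false then Label.l0 else z) ≠ (k, .l0) → i + 1 ≠ k := by
    rintro z h rfl
    simp [hy] at h
  cases l <;> simp only [succB] at h ⊢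
  · exact stepsLeft_add_one_lt (hk _ h) _
  · exact stepsLeft_add_one_lt (hk _ h) _
  all_goals simp [stepsLeft]

theorem stepsLeft_succA_lt {x y : Fin n → Bool} {k : Fin n} (hx : x k = true)
    (huniq : ∀ j, x j > y j → j = k) {v : Vertex n} (hv : v ≠ (k, .l0))
    (hpred : ∃ u, succB y u = v)
    (h1 : succA x v ≠ (k, .l01)) (h2 : succA x v ≠ (k, .l11)) :
    stepsLeft k (succA x v) < stepsLeft k v := by
  obtain ⟨i, l⟩ := v
  cases l <;> simp only [succA] at h1 h2 ⊢
  · have hi : x i = false := by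
      by_contra hxi
      have hyi : y i = false := by
        by_contra hyi
        obtain ⟨u, hu⟩ := hpred
        exact succB_ne_l0 (by simpa using hyi) u hu
      refine hv ?_
      rw [huniq i (by simp_all)]
    simp only [hi, if_true] at h1 ⊢
    refine stepsLeft_add_one_lt ?_ _
    rintro rfl
    simp [hx] at h1
  · refine stepsLeft_add_one_lt ?_ _
    rintro rfl
    simp [hx] at h2
  all_goals simp [stepsLeft]

theorem card_vertex (n : ℕ) : Fintype.card (Vertex n) = 4 * n := by
  rw [Fintype.card_prod, Fintype.card_fin, show Fintype.card Label = 4 from rfl, mul_comm]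

/-- In an approximate correlated equilibrium of the 2-cycle game, player B is at `(k, 0)` or player
A at `(k, 01)` or `(k, 11)` with noticeable probability, where `k` is the special index. -/
theorem IsApproxCorrelatedEq.exists_marginal_gt {x y : Fin n → Bool} {k : Fin n}
    (hk : x k > y k) (huniq : ∀ j, x j > y j → j = k) {ε : ℝ} (hε : 0 ≤ ε)
    (hε' : ε ≤ 1 / (24 * ((4 * n : ℕ) : ℝ) ^ 3)) {μ : Vertex n × Vertex n → ℝ}
    (h : IsApproxCorrelatedEq (utilityA x) (utilityB y) ε μ) :
    (4 * n : ℕ) * ε < ∑ u, μ (u, (k, .l0)) ∨ (4 * n : ℕ) * ε < ∑ v, μ ((k, .l01), v) ∨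
      (4 * n : ℕ) * ε < ∑ v, μ ((k, .l11), v) := by
  by_contra! hcon
  obtain ⟨c0, c1, c2⟩ := hcon
  have hA := h.noGain_succA
  have hB := h.noGain_succB
  have hμ : ∀ w, 0 ≤ μ w := h.1.1
  have hx : x k = true := Bool.eq_true_of_not_eq_false fun hx =>
    absurd hk (by rw [hx]; cases y k <;> decide)
  have hy : y k = false := Bool.eq_false_of_not_eq_true fun hy =>
    absurd hk (by rw [hx, hy]; decide)
  set a := hitMass (succA x) (fun u v => μ (u, v))
  set b := hitMass (succB y) (fun v u => μ (u, v))
  have ha0 : ∀ u, 0 ≤ a u := hitMass_nonneg _ fun u v => hμ _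
  have hb0 : ∀ u, 0 ≤ b u := hitMass_nonneg _ fun u v => hμ _
  have hab : ∀ v, b v ≤ ∑ u with succB y u = v, (a u + ε) :=
    hA.hitMass_swap_le (fun u v => hμ _) _
  have hba : ∀ v, a v ≤ ∑ u with succA x u = v, (b u + ε) :=
    hB.hitMass_swap_le (fun u v => hμ _) _
  have haC : ∀ u ∈ ({(k, .l01), (k, .l11)} : Finset (Vertex n)), a u ≤ (4 * n : ℕ) * ε := by
    intro u hu
    rw [Finset.mem_insert, Finset.mem_singleton] at hu
    rcases hu with rfl | rfl
    · exact (hitMass_le _ (fun u v => hμ _) _).trans c1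
    · exact (hitMass_le _ (fun u v => hμ _) _).trans c2
  have hbD : ∀ u ∈ ({(k, .l0)} : Finset (Vertex n)), b u ≤ (4 * n : ℕ) * ε := by
    intro u hu
    rw [Finset.mem_singleton] at hu
    rw [hu]
    exact (hitMass_le _ (fun u v => hμ _) _).trans c0
  have hθ : 0 ≤ (4 * n : ℕ) * ε := by positivity
  have hM : (0 : ℝ) ≤ (2 * n : ℕ) := by positivity
  have h1 : ∀ v, (1 : ℝ) ≤ stepsLeft k v := fun v => by exact_mod_cast one_le_stepsLeft k v
  have h2 : ∀ v, (stepsLeft k v : ℝ) ≤ (2 * n : ℕ) := fun v => by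
    exact_mod_cast stepsLeft_le k v
  have e1 := sum_potential_mul_le (succB y) a b (fun u => (stepsLeft k u : ℝ))
    (fun u => (stepsLeft k u : ℝ)) _ _ hε hM ha0 hab h1 (fun v => by positivity) h2 haC hbD hθ
    (by
      intro u _ _ hD
      have := stepsLeft_succB_lt hy (fun h => hD (by rw [h]; simp))
      have : stepsLeft k (succB y u) + 1 ≤ stepsLeft k u := this
      have : ((stepsLeft k (succB y u) : ℝ)) + 1 ≤ stepsLeft k u := by exact_mod_cast this
      linarith)
  have e2 := sum_potential_mul_le (succA x) b a (fun u => (stepsLeft k u : ℝ))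
    (fun u => (stepsLeft k u : ℝ)) _ _ hε hM hb0 hba h1 (fun v => by positivity) h2 hbD haC hθ
    (by
      intro u hu h0 hD
      have := stepsLeft_succA_lt hx huniq (by simpa using hu) (exists_of_hitMass_ne_zero h0)
        (fun h => hD (by rw [h]; simp)) (fun h => hD (by rw [h]; simp))
      have : stepsLeft k (succA x u) + 1 ≤ stepsLeft k u := this
      have : ((stepsLeft k (succA x u) : ℝ)) + 1 ≤ stepsLeft k u := by exact_mod_cast this
      linarith)
  have c2' : (({(k, .l01), (k, .l11)} : Finset (Vertex n)).card : ℝ) = 2 := by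
    rw [Finset.card_pair (by simp)]
    norm_num
  have c1' : (({(k, .l0)} : Finset (Vertex n)).card : ℝ) = 1 := by simp
  rw [c1', c2', card_vertex] at e1 e2
  simp only [sub_mul, one_mul, Finset.sum_sub_distrib] at e1 e2
  have hsum : ∑ u, ∑ v, μ (u, v) = 1 := by
    rw [← Fintype.sum_prod_type]
    exact h.1.2
  have s1 : (1 : ℝ) ≤ (4 * n : ℕ) * (∑ u, a u + (4 * n : ℕ) * ε) := by
    rw [← hsum]
    refine (Finset.sum_le_sum fun u _ => hA.marginal_le u).trans_eq ?_
    rw [← Finset.mul_sum, Finset.sum_add_distrib, Finset.sum_const, Finset.card_univ, card_vertex,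
      nsmul_eq_mul]
  have s2 : (1 : ℝ) ≤ (4 * n : ℕ) * (∑ u, b u + (4 * n : ℕ) * ε) := by
    rw [← hsum, Finset.sum_comm]
    refine (Finset.sum_le_sum fun u _ => hB.marginal_le u).trans_eq ?_
    rw [← Finset.mul_sum, Finset.sum_add_distrib, Finset.sum_const, Finset.card_univ, card_vertex,
      nsmul_eq_mul]
  have hn : (1 : ℝ) ≤ n := by exact_mod_cast NeZero.one_le
  push_cast at *
  rw [le_div_iff₀ (by positivity)] at hε'
  have e3 : ∑ u, a u + ∑ u, b u ≤ 4 * (4 * n) ^ 2 * ε := by linarith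
  have e4 : (4 * (n : ℝ)) * (∑ u, a u + ∑ u, b u) ≤ 4 * n * (4 * (4 * n) ^ 2 * ε) := by gcongr
  have e5 : 0 ≤ (n : ℝ) ^ 2 * ε * (n - 1) :=
    mul_nonneg (by positivity) (by linarith)
  nlinarith

end Game

/-! Sums over the Boolean cube -/

/-- The intersection of two Boolean vectors. -/
def andVec {ι : Type*} (t r : ι → Bool) : ι → Bool := fun j => t j && r j

/-- The complement of a Boolean vector. -/
def notVec {ι : Type*} (t : ι → Bool) : ι → Bool := fun j => !t j

theorem notVec_notVec {ι : Type*} (t : ι → Bool) : notVec (notVec t) = t := by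
  funext j
  simp [notVec]

theorem notVec_update {ι : Type*} [DecidableEq ι] (t : ι → Bool) (i : ι) (b : Bool) :
    notVec (Function.update t i b) = Function.update (notVec t) i (!b) := by
  funext j
  by_cases h : j = i
  · subst h; simp [notVec]
  · simp [notVec, h]

section Cube

variable {ι : Type*} [Fintype ι] [DecidableEq ι]

/-- Flipping one coordinate of a Boolean vector. -/
def flipAt (i : ι) : Equiv.Perm (ι → Bool) :=
  Function.Involutive.toPerm (fun r => Function.update r i (!r i)) fun r => by simp

theorem sum_update_eq (h : (ι → Bool) → ℝ) (i : ι) (a : Bool) :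
    ∑ r, h (Function.update r i a) = 2 * ∑ r, if r i = a then h r else 0 := by
  rw [two_mul]
  nth_rewrite 2 [← Equiv.sum_comp (flipAt i)]
  rw [← Finset.sum_add_distrib]
  refine Finset.sum_congr rfl fun r _ => ?_
  rcases Bool.eq_or_eq_not (r i) a with hr | hr
  · subst hr
    simp [flipAt, Function.Involutive.toPerm]
  · simp [flipAt, Function.Involutive.toPerm, hr]

theorem sum_update_add_sum_update (h : (ι → Bool) → ℝ) (i : ι) :
    ∑ r, h (Function.update r i true) + ∑ r, h (Function.update r i false) = 2 * ∑ r, h r := by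
  rw [sum_update_eq, sum_update_eq, ← mul_add, ← Finset.sum_add_distrib]
  congr 1
  refine Finset.sum_congr rfl fun r _ => ?_
  cases r i <;> simp

/-- A subset of the cube in which many coordinates are biased is small. -/
theorem sum_pow_four_le_of_biased (F : (ι → Bool) → ℝ) (h0 : ∀ r, 0 ≤ F r) (h1 : ∀ r, F r ≤ 1)
    (K : Finset ι) (σ : ι → Bool)
    (hK : ∀ i ∈ K, 4 * ∑ r, (if r i = σ i then F r else 0) ≤ ∑ r, F r) :
    (∑ r, F r) ^ 4 ≤ (16 / 27) ^ K.card * ((2 : ℝ) ^ Fintype.card ι) ^ 4 := by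
  set S := ∑ r, F r
  have hS0 : 0 ≤ S := Finset.sum_nonneg fun r _ => h0 r
  rcases hS0.eq_or_lt with h | hpos
  · rw [← h, zero_pow (by norm_num)]
    positivity
  set p : (ι → Bool) → ℝ := fun r => ∑ i ∈ K, if r i = σ i then -Real.log 3 else 0 with hp
  have hJ := convexOn_exp.map_sum_le (t := Finset.univ) (w := fun r => F r / S) (p := p)
    (fun r _ => div_nonneg (h0 r) hpos.le)
    (by rw [← Finset.sum_div, div_self hpos.ne']) (fun _ _ => Set.mem_univ _)
  simp only [smul_eq_mul] at hJ
  have hexp : ∀ r, Real.exp (p r) = ∏ i, if i ∈ K ∧ r i = σ i then (1 / 3 : ℝ) else 1 := by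
    intro r
    rw [hp, Real.exp_sum]
    rw [← Finset.prod_subset (Finset.subset_univ K) (by intro i _ hi; simp [hi])]
    refine Finset.prod_congr rfl fun i hi => ?_
    split_ifs with h h' h'
    · rw [Real.exp_neg, Real.exp_log (by norm_num)]
      norm_num
    · exact absurd ⟨hi, h⟩ h'
    · exact absurd h'.2 h
    · simp
  have hprod : ∑ r, Real.exp (p r) = 2 ^ Fintype.card ι * (2 / 3) ^ K.card := by
    simp only [hexp]
    rw [← Fintype.prod_sum (fun i b => if i ∈ K ∧ b = σ i then (1 / 3 : ℝ) else 1)]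
    have : ∀ i, ∑ b, (if i ∈ K ∧ b = σ i then (1 / 3 : ℝ) else 1) =
        2 * if i ∈ K then 2 / 3 else 1 := by
      intro i
      by_cases hi : i ∈ K <;> cases hσ : σ i <;> simp [hi] <;> norm_num
    simp only [this, Finset.prod_mul_distrib, Finset.prod_const, Finset.card_univ]
    congr 1
    rw [← Finset.prod_filter, Finset.prod_const]
    simp
  have hup : ∑ r, F r / S * Real.exp (p r) ≤ 2 ^ Fintype.card ι * (2 / 3) ^ K.card / S := by
    rw [← hprod, Finset.sum_div]
    refine Finset.sum_le_sum fun r _ => ?_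
    rw [div_mul_eq_mul_div]
    gcongr
    exact mul_le_of_le_one_left (Real.exp_pos _).le (h1 r)
  have hlow : -Real.log 3 * K.card / 4 ≤ ∑ r, F r / S * p r := by
    have e : ∑ r, F r / S * p r =
        ∑ i ∈ K, -Real.log 3 * ((∑ r, if r i = σ i then F r else 0) / S) := by
      simp only [hp, Finset.mul_sum, Finset.sum_div]
      rw [Finset.sum_comm]
      refine Finset.sum_congr rfl fun i _ => Finset.sum_congr rfl fun r _ => ?_
      split_ifs <;> ring
    rw [e]
    have hl : 0 ≤ Real.log 3 := Real.log_nonneg (by norm_num)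
    have : ∀ i ∈ K, -Real.log 3 / 4 ≤
        -Real.log 3 * ((∑ r, if r i = σ i then F r else 0) / S) := by
      intro i hi
      have : (∑ r, if r i = σ i then F r else 0) / S ≤ 1 / 4 := by
        rw [div_le_iff₀ hpos]
        linarith [hK i hi]
      nlinarith
    refine le_trans (le_of_eq ?_) (Finset.sum_le_sum this)
    rw [Finset.sum_const, nsmul_eq_mul]
    ring
  have hmain := (Real.exp_le_exp.2 hlow).trans (hJ.trans hup)
  rw [le_div_iff₀ hpos] at hmain
  have h4 := pow_le_pow_left₀ (by positivity) hmain 4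
  rw [mul_pow, ← Real.exp_nat_mul] at h4
  have e3 : Real.exp ((4 : ℕ) * (-Real.log 3 * K.card / 4)) = (1 / 3) ^ K.card := by
    rw [show ((4 : ℕ) : ℝ) * (-Real.log 3 * K.card / 4) = K.card * (-Real.log 3) by
      push_cast; ring, Real.exp_nat_mul, Real.exp_neg, Real.exp_log (by norm_num), one_div]
  rw [e3] at h4
  calc S ^ 4 = 3 ^ K.card * ((1 / 3) ^ K.card * S ^ 4) := by
        rw [← mul_assoc, ← mul_pow]
        norm_num
    _ ≤ 3 ^ K.card * (2 ^ Fintype.card ι * (2 / 3) ^ K.card) ^ 4 := by gcongr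
    _ = _ := by
        rw [mul_pow, pow_right_comm (2 / 3 : ℝ), show (16 / 27 : ℝ) = 3 * (2 / 3) ^ 4 by norm_num,
          mul_pow 3]
        ring

/-! Disjoint pairs obtained from a mask `t`: the first set lies below `t`, the second below its
complement -/

/-- The sum of `f` over the sets below the mask `t`. -/
def maskSum (f : (ι → Bool) → ℝ) (t : ι → Bool) : ℝ := ∑ r, f (andVec t r)

/-- The sum of `f` over the sets below the mask `t`, with the value at `i` replaced by `a`. -/
def maskSumAt (f : (ι → Bool) → ℝ) (i : ι) (a : Bool) (t : ι → Bool) : ℝ :=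
  ∑ r, f (Function.update (andVec t r) i a)

theorem maskSum_nonneg {f : (ι → Bool) → ℝ} (hf : ∀ x, 0 ≤ f x) (t : ι → Bool) :
    0 ≤ maskSum f t := Finset.sum_nonneg fun _ _ => hf _

theorem maskSumAt_nonneg {f : (ι → Bool) → ℝ} (hf : ∀ x, 0 ≤ f x) (i : ι) (a : Bool)
    (t : ι → Bool) : 0 ≤ maskSumAt f i a t := Finset.sum_nonneg fun _ _ => hf _

theorem maskSum_le {f : (ι → Bool) → ℝ} (hf : ∀ x, f x ≤ 1) (t : ι → Bool) :
    maskSum f t ≤ 2 ^ Fintype.card ι :=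
  (Finset.sum_le_sum fun _ _ => hf _).trans_eq (by simp)

theorem maskSumAt_update (f : (ι → Bool) → ℝ) (i : ι) (a b : Bool) (t : ι → Bool) :
    maskSumAt f i a (Function.update t i b) = maskSumAt f i a t := by
  unfold maskSumAt
  refine Finset.sum_congr rfl fun r _ => congrArg f ?_
  funext j
  by_cases h : j = i
  · subst h; simp
  · simp [andVec, h]

theorem maskSumAt_eq_two_mul (f : (ι → Bool) → ℝ) {i : ι} (a : Bool) {t : ι → Bool}
    (ht : t i = true) :
    maskSumAt f i a t = 2 * ∑ r, if r i = a then f (andVec t r) else 0 := by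
  rw [← sum_update_eq (fun r => f (andVec t r))]
  refine Finset.sum_congr rfl fun r _ => congrArg f ?_
  funext j
  by_cases h : j = i
  · subst h; simp [andVec, ht]
  · simp [andVec, h]

theorem maskSumAt_add (f : (ι → Bool) → ℝ) {i : ι} {t : ι → Bool} (ht : t i = true) :
    maskSumAt f i false t + maskSumAt f i true t = 2 * maskSum f t := by
  rw [maskSumAt_eq_two_mul f _ ht, maskSumAt_eq_two_mul f _ ht, ← mul_add,
    ← Finset.sum_add_distrib]
  congr 1
  refine Finset.sum_congr rfl fun r _ => ?_
  cases r i <;> simp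

theorem maskSumAt_false (f : (ι → Bool) → ℝ) {i : ι} {t : ι → Bool} (ht : t i = false) :
    maskSumAt f i false t = maskSum f t := by
  refine Finset.sum_congr rfl fun r _ => congrArg f ?_
  funext j
  by_cases h : j = i
  · subst h; simp [andVec, ht]
  · simp [h]

/-- The coordinate `i` is strongly biased within the support of `f` below the mask `t`. -/
def Skew (f : (ι → Bool) → ℝ) (i : ι) (t : ι → Bool) : Prop :=
  3 * maskSumAt f i false t < maskSumAt f i true t ∨
    3 * maskSumAt f i true t < maskSumAt f i false t

theorem skew_update (f : (ι → Bool) → ℝ) (i : ι) (b : Bool) (t : ι → Bool) :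
    Skew f i (Function.update t i b) ↔ Skew f i t := by
  simp only [Skew, maskSumAt_update]

open Classical in
theorem card_skew_mul_maskSum_le {f : (ι → Bool) → ℝ} (h0 : ∀ x, 0 ≤ f x) (h1 : ∀ x, f x ≤ 1)
    (t : ι → Bool) {τ : ℝ} (hτ0 : 0 ≤ τ) (hτ : (16 / 27) ^ Fintype.card ι ≤ τ ^ 80) :
    ((Finset.univ.filter fun i => t i = true ∧ Skew f i t).card : ℝ) * maskSum f t ≤
      Fintype.card ι * (maskSum f t / 20 + τ * 2 ^ Fintype.card ι) := by
  set K := Finset.univ.filter fun i => t i = true ∧ Skew f i t with hKdef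
  have hP := maskSum_nonneg h0 t
  have hM : (0 : ℝ) < 2 ^ Fintype.card ι := by positivity
  have hKn : (K.card : ℝ) ≤ Fintype.card ι := by exact_mod_cast Finset.card_le_univ K
  rcases le_or_gt (20 * K.card) (Fintype.card ι) with hc | hc
  · have hc' : (20 : ℝ) * K.card ≤ Fintype.card ι := by exact_mod_cast hc
    have : (K.card : ℝ) * maskSum f t ≤ Fintype.card ι / 20 * maskSum f t := by
      gcongr
      linarith
    have : 0 ≤ Fintype.card ι * (τ * 2 ^ Fintype.card ι) := by positivity
    linarith
  · have hb := sum_pow_four_le_of_biased (fun r => f (andVec t r)) (fun _ => h0 _) (fun _ => h1 _)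
      K (fun i => if 3 * maskSumAt f i false t < maskSumAt f i true t then false else true) (by
        intro i hi
        obtain ⟨-, hti, hs⟩ := Finset.mem_filter.1 hi
        have hadd := maskSumAt_add f hti
        change 4 * _ ≤ maskSum f t
        split_ifs with hlt
        · have := maskSumAt_eq_two_mul f false hti
          linarith
        · have := maskSumAt_eq_two_mul f true hti
          have := hs.resolve_left hlt
          linarith)
    change maskSum f t ^ 4 ≤ _ at hb
    have h80 : maskSum f t ^ 80 ≤ (τ * 2 ^ Fintype.card ι) ^ 80 := by
      calc maskSum f t ^ 80 = (maskSum f t ^ 4) ^ 20 := by rw [← pow_mul]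
        _ ≤ ((16 / 27) ^ K.card * ((2 : ℝ) ^ Fintype.card ι) ^ 4) ^ 20 :=
          pow_le_pow_left₀ (by positivity) hb 20
        _ = (16 / 27) ^ (20 * K.card) * ((2 : ℝ) ^ Fintype.card ι) ^ 80 := by
          rw [mul_pow, ← pow_mul, ← pow_mul, mul_comm K.card 20]
        _ ≤ (16 / 27) ^ Fintype.card ι * ((2 : ℝ) ^ Fintype.card ι) ^ 80 := by
          gcongr ?_ * _
          exact pow_le_pow_of_le_one (by norm_num) (by norm_num) hc.le
        _ ≤ _ := by
          rw [mul_pow]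
          gcongr
    have hle := le_of_pow_le_pow_left₀ (by norm_num) (by positivity) h80
    calc (K.card : ℝ) * maskSum f t ≤ Fintype.card ι * (τ * 2 ^ Fintype.card ι) := by gcongr
      _ ≤ _ := by
        gcongr
        linarith

/-- Complementation as a permutation of the cube. -/
def notEquiv (ι : Type*) : Equiv.Perm (ι → Bool) :=
  Function.Involutive.toPerm notVec notVec_notVec

/-- The sum of `f x * g y` over the disjoint pairs, weighted by the number of masks. -/
def disjSum (f g : (ι → Bool) → ℝ) : ℝ := ∑ t, maskSum f t * maskSum g (notVec t)

theorem disjSum_comm (f g : (ι → Bool) → ℝ) : disjSum f g = disjSum g f := by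
  unfold disjSum
  rw [← Equiv.sum_comp (notEquiv ι)]
  refine Finset.sum_congr rfl fun t _ => ?_
  change maskSum f (notVec t) * maskSum g (notVec (notVec t)) = _
  rw [notVec_notVec, mul_comm]

theorem sum_maskSumAt_eq_disjSum (f g : (ι → Bool) → ℝ) (i : ι) :
    ∑ t, ((maskSumAt f i false t + maskSumAt f i true t) * maskSumAt g i false (notVec t) +
      maskSumAt f i false t *
        (maskSumAt g i false (notVec t) + maskSumAt g i true (notVec t))) / 4 =
      disjSum f g := by
  have h := sum_update_add_sum_update (fun t => maskSum f t * maskSum g (notVec t)) i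
  have e1 : ∀ t, maskSum f (Function.update t i true) *
      maskSum g (notVec (Function.update t i true)) =
      (maskSumAt f i false t + maskSumAt f i true t) / 2 * maskSumAt g i false (notVec t) := by
    intro t
    have := maskSumAt_add f (i := i) (t := Function.update t i true) (by simp)
    rw [maskSumAt_update, maskSumAt_update] at this
    rw [this, notVec_update, ← maskSumAt_false g (i := i) (by simp), maskSumAt_update]
    ring
  have e2 : ∀ t, maskSum f (Function.update t i false) *
      maskSum g (notVec (Function.update t i false)) =
      maskSumAt f i false t *
        ((maskSumAt g i false (notVec t) + maskSumAt g i true (notVec t)) / 2) := by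
    intro t
    have := maskSumAt_add g (i := i) (t := Function.update (notVec t) i true) (by simp)
    rw [maskSumAt_update, maskSumAt_update] at this
    rw [this, notVec_update, ← maskSumAt_false f (i := i) (by simp), maskSumAt_update]
    simp only [Bool.not_false]
    ring
  simp only [e1, e2] at h
  rw [← Finset.sum_add_distrib] at h
  unfold disjSum
  rw [← mul_right_inj' (two_ne_zero (α := ℝ)), ← h, Finset.mul_sum]
  refine Finset.sum_congr rfl fun t _ => ?_
  ring

open Classical in
theorem sum_skew_le {f g : (ι → Bool) → ℝ} (hf0 : ∀ x, 0 ≤ f x) (hf1 : ∀ x, f x ≤ 1)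
    (hg0 : ∀ x, 0 ≤ g x) (hg1 : ∀ x, g x ≤ 1) {τ : ℝ} (hτ0 : 0 ≤ τ)
    (hτ : (16 / 27) ^ Fintype.card ι ≤ τ ^ 80) :
    ∑ i, ∑ t, (if Skew f i t then (maskSumAt f i false t + maskSumAt f i true t) *
        maskSumAt g i false (notVec t) else 0) ≤
      Fintype.card ι * (disjSum f g / 5 + 4 * τ * (2 ^ Fintype.card ι) ^ 3) := by
  have e : ∀ i, ∑ t, (if Skew f i t then (maskSumAt f i false t + maskSumAt f i true t) *
        maskSumAt g i false (notVec t) else 0) =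
      4 * ∑ t, if t i = true ∧ Skew f i t then maskSum f t * maskSum g (notVec t) else 0 := by
    intro i
    have h := sum_update_eq (fun t => if Skew f i t then
      maskSum f t * maskSum g (notVec t) else 0) i true
    simp only [skew_update] at h
    simp only [ite_and]
    rw [show (4 : ℝ) = 2 * 2 by norm_num, mul_assoc, ← h, Finset.mul_sum]
    refine Finset.sum_congr rfl fun t _ => ?_
    split_ifs
    · have := maskSumAt_add f (i := i) (t := Function.update t i true) (by simp)
      rw [maskSumAt_update, maskSumAt_update] at this
      rw [this, notVec_update, ← maskSumAt_false g (i := i) (by simp), maskSumAt_update]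
      ring
    · simp
  simp only [e]
  rw [← Finset.mul_sum, Finset.sum_comm]
  have h1 : ∀ t, ∑ i, (if t i = true ∧ Skew f i t then maskSum f t * maskSum g (notVec t) else 0) ≤
      Fintype.card ι * (maskSum f t * maskSum g (notVec t) / 20 +
        τ * 2 ^ Fintype.card ι * 2 ^ Fintype.card ι) := by
    intro t
    rw [← Finset.sum_filter, Finset.sum_const, nsmul_eq_mul, ← mul_assoc]
    have hg := maskSum_nonneg hg0 (notVec t)
    refine (mul_le_mul_of_nonneg_right (card_skew_mul_maskSum_le hf0 hf1 t hτ0 hτ) hg).trans ?_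
    rw [mul_assoc]
    gcongr
    have : τ * 2 ^ Fintype.card ι * maskSum g (notVec t) ≤
        τ * 2 ^ Fintype.card ι * 2 ^ Fintype.card ι := by
      gcongr
      exact maskSum_le hg1 _
    linarith
  refine (mul_le_mul_of_nonneg_left (Finset.sum_le_sum fun t _ => h1 t) (by norm_num)).trans_eq ?_
  rw [← Finset.mul_sum, Finset.sum_add_distrib, ← Finset.sum_div]
  simp only [Finset.sum_const, Finset.card_univ, Fintype.card_fun, Fintype.card_bool,
    nsmul_eq_mul]
  unfold disjSum
  push_cast
  ring

open Classical in
/-- Corruption: a rectangle that contains many disjoint pairs contains many pairs with exactly one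
common element. -/
theorem disjSum_le {f g : (ι → Bool) → ℝ} (hf0 : ∀ x, 0 ≤ f x) (hf1 : ∀ x, f x ≤ 1)
    (hg0 : ∀ x, 0 ≤ g x) (hg1 : ∀ x, g x ≤ 1) {τ : ℝ} (hτ0 : 0 ≤ τ)
    (hτ : (16 / 27) ^ Fintype.card ι ≤ τ ^ 80) :
    Fintype.card ι * disjSum f g ≤
      36 * ∑ i, ∑ t, maskSumAt f i true t * maskSumAt g i true (notVec t) +
        20 * Fintype.card ι * τ * (2 ^ Fintype.card ι) ^ 3 := by
  have hX := sum_skew_le hf0 hf1 hg0 hg1 hτ0 hτ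
  have hY := sum_skew_le hg0 hg1 hf0 hf1 hτ0 hτ
  have hY' : ∑ i, ∑ t, (if Skew g i (notVec t) then maskSumAt f i false t *
      (maskSumAt g i false (notVec t) + maskSumAt g i true (notVec t)) else 0) ≤
      Fintype.card ι * (disjSum f g / 5 + 4 * τ * (2 ^ Fintype.card ι) ^ 3) := by
    rw [disjSum_comm f g]
    refine le_trans (le_of_eq ?_) hY
    refine Finset.sum_congr rfl fun i _ => ?_
    rw [← Equiv.sum_comp (notEquiv ι)]
    refine Finset.sum_congr rfl fun t _ => ?_
    change (if Skew g i (notVec (notVec t)) then maskSumAt f i false (notVec t) *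
      (maskSumAt g i false (notVec (notVec t)) + maskSumAt g i true (notVec (notVec t)))
      else 0) = _
    simp only [notVec_notVec, mul_comm]
  have hpt : ∀ i t,
      ((maskSumAt f i false t + maskSumAt f i true t) * maskSumAt g i false (notVec t) +
      maskSumAt f i false t *
        (maskSumAt g i false (notVec t) + maskSumAt g i true (notVec t))) / 4 ≤
      18 * (maskSumAt f i true t * maskSumAt g i true (notVec t)) + 5 / 4 *
      ((if Skew f i t then (maskSumAt f i false t + maskSumAt f i true t) *
        maskSumAt g i false (notVec t) else 0) +
       (if Skew g i (notVec t) then maskSumAt f i false t *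
        (maskSumAt g i false (notVec t) + maskSumAt g i true (notVec t)) else 0)) := by
    intro i t
    have p0 := maskSumAt_nonneg hf0 i false t
    have p1 := maskSumAt_nonneg hf0 i true t
    have q0 := maskSumAt_nonneg hg0 i false (notVec t)
    have q1 := maskSumAt_nonneg hg0 i true (notVec t)
    have h00 := mul_nonneg p0 q0
    have h01 := mul_nonneg p0 q1
    have h10 := mul_nonneg p1 q0
    have h11 := mul_nonneg p1 q1
    by_cases hx : Skew f i t <;> by_cases hy : Skew g i (notVec t)
    · rw [if_pos hx, if_pos hy]
      linarith
    · rw [if_pos hx, if_neg hy]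
      rw [Skew, not_or, not_lt, not_lt] at hy
      have := mul_le_mul_of_nonneg_left hy.1 p0
      linarith
    · rw [if_neg hx, if_pos hy]
      rw [Skew, not_or, not_lt, not_lt] at hx
      have := mul_le_mul_of_nonneg_right hx.1 q0
      linarith
    · rw [if_neg hx, if_neg hy]
      rw [Skew, not_or, not_lt, not_lt] at hx hy
      have a1 := mul_le_mul_of_nonneg_left hy.1 p0
      have a2 := mul_le_mul_of_nonneg_right hx.1 q0
      have a3 := mul_le_mul_of_nonneg_right hx.2 q0
      have a4 := mul_le_mul_of_nonneg_left hy.2 p1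
      linarith
  have hsum := Finset.sum_le_sum fun i (_ : i ∈ Finset.univ) =>
    Finset.sum_le_sum fun t (_ : t ∈ Finset.univ) => hpt i t
  simp only [sum_maskSumAt_eq_disjSum, Finset.sum_add_distrib, ← Finset.mul_sum] at hsum
  rw [Finset.sum_const, Finset.card_univ, nsmul_eq_mul] at hsum
  linarith

end Cube

/-! Rectangular labellings -/

/-- All fibres of the labelling `c` of `X × Y` are rectangles. -/
def IsRectangular {X Y L : Type*} (c : X → Y → L) : Prop :=
  ∀ x y x' y', c x y = c x' y' → c x y' = c x y

section Rejection

variable {ι : Type*} [Fintype ι] [DecidableEq ι]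

/-- The pair of sets with the single common element `i` given by a mask and two random sets. -/
def crossPair (w : ι × (ι → Bool) × (ι → Bool) × (ι → Bool)) : (ι → Bool) × (ι → Bool) :=
  (Function.update (andVec w.2.1 w.2.2.1) w.1 true,
    Function.update (andVec (notVec w.2.1) w.2.2.2) w.1 true)

open Classical in
/-- If a union of few rectangles contains all pairs of disjoint sets, then it contains a constant
fraction of the pairs of sets with exactly one common element. -/
theorem card_crossPair_ge {L : Type*} [Fintype L] {c : (ι → Bool) → (ι → Bool) → L}
    (hc : IsRectangular c) (rej : L → Prop)
    (hdisj : ∀ x y, (∀ i, ¬ (x i = true ∧ y i = true)) → rej (c x y)) {τ : ℝ} (hτ0 : 0 ≤ τ)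
    (hτ : (16 / 27) ^ Fintype.card ι ≤ τ ^ 80) :
    Fintype.card ι * ((2 : ℝ) ^ Fintype.card ι) ^ 3 * (1 - 20 * τ * Fintype.card L) ≤
      36 * ((Finset.univ.filter fun w : ι × (ι → Bool) × (ι → Bool) × (ι → Bool) =>
        rej (c (crossPair w).1 (crossPair w).2)).card : ℝ) := by
  set f : L → (ι → Bool) → ℝ := fun l x => if ∃ y, c x y = l then 1 else 0 with hf
  set g : L → (ι → Bool) → ℝ := fun l y => if ∃ x, c x y = l then 1 else 0 with hg
  have hfg : ∀ l x y, f l x * g l y = if c x y = l then 1 else 0 := by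
    intro l x y
    simp only [hf, hg]
    by_cases h : c x y = l
    · rw [if_pos ⟨y, h⟩, if_pos ⟨x, h⟩, if_pos h, one_mul]
    · rw [if_neg h]
      by_cases h1 : ∃ y', c x y' = l
      · by_cases h2 : ∃ x', c x' y = l
        · obtain ⟨y', h1⟩ := h1
          obtain ⟨x', h2⟩ := h2
          exact absurd ((hc x y' x' y (h1.trans h2.symm)).trans h1) h
        · rw [if_neg h2, mul_zero]
      · rw [if_neg h1, zero_mul]
  have hf0 : ∀ l x, 0 ≤ f l x := fun l x => by simp only [hf]; split_ifs <;> norm_num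
  have hf1 : ∀ l x, f l x ≤ 1 := fun l x => by simp only [hf]; split_ifs <;> norm_num
  have hg0 : ∀ l x, 0 ≤ g l x := fun l x => by simp only [hg]; split_ifs <;> norm_num
  have hg1 : ∀ l x, g l x ≤ 1 := fun l x => by simp only [hg]; split_ifs <;> norm_num
  have hl : ∀ x y, rej (c x y) → ∑ l with rej l, f l x * g l y = 1 := by
    intro x y h
    simp [hfg, h]
  have hl' : ∀ x y, ∑ l with rej l, f l x * g l y = if rej (c x y) then 1 else 0 := by
    intro x y
    simp [hfg]
  have h0 : ∑ l with rej l, disjSum (f l) (g l) = ((2 : ℝ) ^ Fintype.card ι) ^ 3 := by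
    simp only [disjSum, maskSum, Finset.sum_mul_sum]
    rw [Finset.sum_comm]
    have : ∀ t : ι → Bool, ∑ l with rej l, ∑ r, ∑ s, f l (andVec t r) * g l (andVec (notVec t) s) =
        2 ^ Fintype.card ι * 2 ^ Fintype.card ι := by
      intro t
      rw [Finset.sum_comm]
      simp_rw [Finset.sum_comm (s := Finset.univ.filter _)]
      rw [Finset.sum_congr rfl fun r _ => Finset.sum_congr rfl fun s _ => hl _ _ (hdisj _ _ ?_)]
      · simp
      · intro i
        cases h : t i <;> simp [andVec, notVec, h]
    simp only [this, Finset.sum_const, Finset.card_univ, Fintype.card_fun, Fintype.card_bool,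
      nsmul_eq_mul]
    push_cast
    ring
  have h1 : ∑ l with rej l, ∑ i, ∑ t, maskSumAt (f l) i true t * maskSumAt (g l) i true (notVec t) =
      ((Finset.univ.filter fun w : ι × (ι → Bool) × (ι → Bool) × (ι → Bool) =>
        rej (c (crossPair w).1 (crossPair w).2)).card : ℝ) := by
    rw [Finset.card_filter]
    push_cast
    simp only [maskSumAt, Finset.sum_mul_sum, Fintype.sum_prod_type, crossPair]
    rw [Finset.sum_comm]
    refine Finset.sum_congr rfl fun i _ => ?_
    rw [Finset.sum_comm]
    refine Finset.sum_congr rfl fun t _ => ?_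
    rw [Finset.sum_comm]
    refine Finset.sum_congr rfl fun r _ => ?_
    rw [Finset.sum_comm]
    refine Finset.sum_congr rfl fun s _ => ?_
    rw [hl']
    congr
  have hsum := Finset.sum_le_sum fun l (_ : l ∈ Finset.univ.filter rej) =>
    disjSum_le (hf0 l) (hf1 l) (hg0 l) (hg1 l) hτ0 hτ
  rw [Finset.sum_add_distrib, ← Finset.mul_sum, ← Finset.mul_sum, h0, h1, Finset.sum_const,
    nsmul_eq_mul] at hsum
  have hcard : ((Finset.univ.filter rej).card : ℝ) ≤ Fintype.card L := by
    exact_mod_cast Finset.card_le_univ _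
  have := mul_le_mul_of_nonneg_right hcard
    (show 0 ≤ 20 * (Fintype.card ι : ℝ) * τ * (2 ^ Fintype.card ι) ^ 3 by positivity)
  linarith

end Rejection

section Labelling

variable {X Y O : Type*}

theorem IsRectangular.refine {L G H : Type*} {c : X → Y → L} (hc : IsRectangular c)
    (g : L → X → G) (h : L → Y → H) :
    IsRectangular fun x y => (c x y, g (c x y) x, h (c x y) y) := by
  intro x y x' y' e
  simp only [Prod.mk.injEq] at e ⊢
  obtain ⟨e1, e2, e3⟩ := e
  have := hc _ _ _ _ e1
  rw [this, e3, e1]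
  exact ⟨rfl, rfl, rfl⟩

/-- The transcripts of a protocol, cut off after `C` bits, label the input pairs in such a way that
the fibres are rectangles and each player's output is determined by the label and that player's
input. -/
theorem Protocol.exists_labelling [Inhabited O] (C : ℕ) (T : Protocol X Y O) :
    ∃ (L : Type) (_ : Fintype L) (c : X → Y → L) (oA : L → X → O) (oB : L → Y → O),
      Fintype.card L ≤ 2 ^ C ∧ IsRectangular c ∧
      ∀ x y, T.bits x y ≤ C → T.run x y = (oA (c x y) x, oB (c x y) y) := by
  induction C generalizing T with
  | zero =>
    refine ⟨Unit, inferInstance, fun _ _ => (), ?_⟩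
    cases T with
    | output a b =>
      exact ⟨fun _ => a, fun _ => b, by simp, fun _ _ _ _ _ => rfl, fun _ _ _ => rfl⟩
    | sendA bit next =>
      exact ⟨default, default, by simp, fun _ _ _ _ _ => rfl, fun x y h => by simp [bits] at h⟩
    | sendB bit next =>
      exact ⟨default, default, by simp, fun _ _ _ _ _ => rfl, fun x y h => by simp [bits] at h⟩
  | succ C ih =>
    cases T with
    | output a b =>
      exact ⟨Unit, inferInstance, fun _ _ => (), fun _ => a, fun _ => b, by simp [Nat.one_le_two_pow],
        fun _ _ _ _ _ => rfl, fun _ _ _ => rfl⟩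
    | sendA bit next =>
      choose L inst c oA oB hcard hrect hrun using fun b => ih (next b)
      refine ⟨Σ b, L b, inferInstance, fun x y => ⟨bit x, c (bit x) x y⟩, fun l => oA l.1 l.2,
        fun l => oB l.1 l.2, ?_, ?_, ?_⟩
      · simp only [Fintype.card_sigma, Fintype.univ_bool, Finset.mem_singleton, Bool.true_eq_false,
          not_false_eq_true, Finset.sum_insert, Finset.sum_singleton]
        have := hcard true
        have := hcard false
        rw [pow_succ]
        omega
      · intro x y x' y' h
        obtain ⟨h1, h2⟩ := Sigma.mk.inj_iff.1 h
        rw [← h1] at h2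
        simp only [hrect _ _ _ _ _ (eq_of_heq h2)]
      · intro x y h
        exact hrun _ x y (by simpa [bits] using h)
    | sendB bit next =>
      choose L inst c oA oB hcard hrect hrun using fun b => ih (next b)
      refine ⟨Σ b, L b, inferInstance, fun x y => ⟨bit y, c (bit y) x y⟩, fun l => oA l.1 l.2,
        fun l => oB l.1 l.2, ?_, ?_, ?_⟩
      · simp only [Fintype.card_sigma, Fintype.univ_bool, Finset.mem_singleton, Bool.true_eq_false,
          not_false_eq_true, Finset.sum_insert, Finset.sum_singleton]
        have := hcard true
        have := hcard false
        rw [pow_succ]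
        omega
      · intro x y x' y' h
        obtain ⟨h1, h2⟩ := Sigma.mk.inj_iff.1 h
        dsimp only at h2 ⊢
        rw [← h1] at h2 ⊢
        rw [hrect _ _ _ _ _ (eq_of_heq h2)]
      · intro x y h
        exact hrun _ x y (by simpa [bits] using h)

end Labelling

/-! Recovering the special index from an approximate correlated equilibrium -/

section Candidates

variable {n : ℕ}

/-- Index `i` looks to player A, with string `x`, like the special index of the game. -/
def LooksSpecialA (ε : ℝ) (μ : Vertex n × Vertex n → ℝ) (x : Fin n → Bool) (i : Fin n) : Prop :=
  x i = true ∧ (4 * n : ℕ) * ε < ∑ u, μ (u, (i, .l0))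

/-- Index `i` looks to player B, with string `y`, like the special index of the game. -/
def LooksSpecialB (ε : ℝ) (μ : Vertex n × Vertex n → ℝ) (y : Fin n → Bool) (i : Fin n) : Prop :=
  y i = false ∧ ((4 * n : ℕ) * ε < ∑ v, μ ((i, .l01), v) ∨ (4 * n : ℕ) * ε < ∑ v, μ ((i, .l11), v))

open Classical in
/-- Some element with property `p`, if there is one. -/
noncomputable def someWitness {α : Type*} (p : α → Prop) : Option α :=
  if h : ∃ a, p a then some h.choose else none

theorem of_mem_someWitness {α : Type*} {p : α → Prop} {a : α} (h : someWitness p = some a) :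
    p a := by
  unfold someWitness at h
  split_ifs at h with h'
  rw [← Option.some.inj h]
  exact h'.choose_spec

theorem exists_mem_someWitness {α : Type*} {p : α → Prop} (h : ∃ a, p a) :
    ∃ a, someWitness p = some a :=
  ⟨h.choose, dif_pos h⟩

open Classical in
/-- The output of a protocol, together with a short verification, splits the input pairs into few
rectangles, some of which are rejected: those of disjoint sets are, those on which the
protocol succeeds are not. -/
theorem Protocol.exists_rejecting_labelling [NeZero n] {X Y : Type*}
    (T : Protocol X Y (Vertex n × Vertex n → ℝ)) (f g : (Fin n → Bool) → _) (C : ℕ) {ε : ℝ}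
    (hε : 0 ≤ ε) (hε' : ε ≤ 1 / (24 * ((4 * n : ℕ) : ℝ) ^ 3)) :
    ∃ (L : Type) (_ : Fintype L) (c : (Fin n → Bool) → (Fin n → Bool) → L) (rej : L → Prop),
      Fintype.card L ≤ 2 ^ C * (4 * (n + 1) ^ 2) ∧ IsRectangular c ∧
      (∀ x z, (∀ i, ¬ (x i = true ∧ z i = true)) → rej (c x z)) ∧
      ∀ x z, (∃! i, x i > notVec z i) → T.bits (f x) (g z) ≤ C →
        (∃ μ, T.run (f x) (g z) = (μ, μ) ∧
          IsApproxCorrelatedEq (utilityA x) (utilityB (notVec z)) ε μ) → ¬ rej (c x z) := by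
  obtain ⟨L, inst, c, oA, oB, hcard, hrect, hrun⟩ := T.exists_labelling C
  set α : L → (Fin n → Bool) → Option (Fin n) := fun l x =>
    someWitness (LooksSpecialA ε (oA l (f x)) x) with hα
  set β : L → (Fin n → Bool) → Option (Fin n) := fun l z =>
    someWitness (LooksSpecialB ε (oB l (g z)) (notVec z)) with hβ
  have hrect0 : IsRectangular fun x z => c (f x) (g z) := fun x z x' z' h => hrect _ _ _ _ h
  have hrect' := (hrect0.refine α β).refine
    (fun l x => decide (∃ i, l.2.2 = some i ∧ x i = true))
    (fun l z => decide (∃ i, l.2.1 = some i ∧ z i = true))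
  refine ⟨_, inferInstance, _, fun l => l.2.1 = false ∧ l.2.2 = false, ?_, hrect', ?_, ?_⟩
  · simp only [Fintype.card_prod, Fintype.card_option, Fintype.card_fin, Fintype.card_bool]
    calc _ = Fintype.card L * (4 * (n + 1) ^ 2) := by ring
      _ ≤ _ := Nat.mul_le_mul_right _ hcard
  · intro x z hd
    simp only [decide_eq_false_iff_not]
    constructor
    · rintro ⟨i, hi, hx⟩
      exact hd i ⟨hx, by simpa [notVec] using (of_mem_someWitness hi).1⟩
    · rintro ⟨i, hi, hz⟩
      exact hd i ⟨(of_mem_someWitness hi).1, hz⟩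
  · rintro x z ⟨k, hk, huniq⟩ hbits ⟨μ, hμ, heq⟩ hrej
    simp only [decide_eq_false_iff_not] at hrej
    rw [hrun _ _ hbits, Prod.mk.injEq] at hμ
    have hA : x k = true := Bool.eq_true_of_not_eq_false fun hx =>
      absurd hk (by simp only [hx]; cases notVec z k <;> decide)
    have hB : notVec z k = false := Bool.eq_false_of_not_eq_true fun hy =>
      absurd hk (by simp only [hA, hy]; decide)
    have main : (∃ i, LooksSpecialA ε μ x i) ∨ ∃ i, LooksSpecialB ε μ (notVec z) i := by
      rcases heq.exists_marginal_gt hk (fun j hj => huniq j hj) hε hε' with h | h | h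
      · exact Or.inl ⟨k, hA, h⟩
      · exact Or.inr ⟨k, hB, Or.inl h⟩
      · exact Or.inr ⟨k, hB, Or.inr h⟩
    rcases main with h | h
    · obtain ⟨i, hi⟩ := exists_mem_someWitness h
      refine hrej.2 ⟨i, by simp only [hα, hμ.1, hi], ?_⟩
      by_contra hz
      have := heq.noGain_succB.marginal_le_of_forall_ne
        (succB_ne_l0 (y := notVec z) (i := i) (by simpa [notVec] using hz))
      rw [card_vertex] at this
      exact absurd (of_mem_someWitness hi).2 this.not_gt
    · obtain ⟨i, hi⟩ := exists_mem_someWitness h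
      refine hrej.1 ⟨i, by simp only [hβ, hμ.2, hi], ?_⟩
      by_contra hx
      rw [Bool.not_eq_true] at hx
      have h1 := heq.noGain_succA.marginal_le_of_forall_ne (succA_ne_l01 (i := i) hx)
      have h2 := heq.noGain_succA.marginal_le_of_forall_ne (succA_ne_l11 (i := i) hx)
      rw [card_vertex] at h1 h2
      exact (of_mem_someWitness hi).2.elim (fun h => absurd h h1.not_gt)
        (fun h => absurd h h2.not_gt)

end Candidates

/-! Choosing good coins -/

section Coins

open Classical in
theorem exists_three_mul_card_le {Ω J : Type*} [MeasurableSpace Ω] (P : Measure Ω)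
    [IsProbabilityMeasure P] (fail : J → Set Ω) (hfail : ∀ j, P (fail j) ≤ 1 / 3)
    (W : Finset J) : ∃ ω, 3 * (W.filter fun j => ω ∈ fail j).card ≤ W.card := by
  obtain ⟨ω, hω⟩ := exists_le_lintegral (μ := P)
    (f := fun ω => ∑ j ∈ W, (toMeasurable P (fail j)).indicator (fun _ => (1 : ℝ≥0∞)) ω)
    (Finset.aemeasurable_fun_sum _ fun j _ =>
      (measurable_const.indicator (measurableSet_toMeasurable _ _)).aemeasurable)
  refine ⟨ω, ?_⟩
  rw [lintegral_finsetSum _ fun j _ => measurable_const.indicator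
    (measurableSet_toMeasurable _ _)] at hω
  simp only [lintegral_indicator_const (measurableSet_toMeasurable _ _), measure_toMeasurable,
    one_mul] at hω
  have h1 : ((W.filter fun j => ω ∈ fail j).card : ℝ≥0∞) ≤ W.card * (1 / 3) := by
    calc ((W.filter fun j => ω ∈ fail j).card : ℝ≥0∞)
        = ∑ j ∈ W, (fail j).indicator (fun _ => (1 : ℝ≥0∞)) ω := by
          simp [Set.indicator_apply, Finset.sum_boole]
      _ ≤ ∑ j ∈ W, (toMeasurable P (fail j)).indicator (fun _ => (1 : ℝ≥0∞)) ω :=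
          Finset.sum_le_sum fun j _ => Set.indicator_le_indicator_of_subset
            (subset_toMeasurable _ _) (fun _ => zero_le) ω
      _ ≤ ∑ j ∈ W, P (fail j) := hω
      _ ≤ ∑ j ∈ W, (1 / 3 : ℝ≥0∞) := Finset.sum_le_sum fun j _ => hfail j
      _ = _ := by rw [Finset.sum_const, nsmul_eq_mul]
  have h2 : (3 : ℝ≥0∞) * (W.filter fun j => ω ∈ fail j).card ≤ W.card := by
    calc (3 : ℝ≥0∞) * (W.filter fun j => ω ∈ fail j).card ≤ 3 * (W.card * (1 / 3)) := by gcongr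
      _ = W.card * (3 * 3⁻¹) := by rw [one_div]; ring
      _ = W.card := by rw [ENNReal.mul_inv_cancel (by norm_num) (by norm_num), mul_one]
  exact_mod_cast h2

open Classical in
/-- There are `m` outcomes of the coins such that at most a `3⁻ᵐ`-fraction of the inputs fails for
all of them. -/
theorem exists_pow_mul_card_le {Ω J : Type*} [Fintype J] [MeasurableSpace Ω] (P : Measure Ω)
    [IsProbabilityMeasure P] (fail : J → Set Ω) (hfail : ∀ j, P (fail j) ≤ 1 / 3) (m : ℕ) :
    ∃ ω : Fin m → Ω, 3 ^ m * (Finset.univ.filter fun j => ∀ k, ω k ∈ fail j).card ≤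
      Fintype.card J := by
  induction m with
  | zero => exact ⟨Fin.elim0, by simp⟩
  | succ m ih =>
    obtain ⟨ω, hω⟩ := ih
    obtain ⟨ω', hω'⟩ := exists_three_mul_card_le P fail hfail
      (Finset.univ.filter fun j => ∀ k, ω k ∈ fail j)
    refine ⟨Fin.cons ω' ω, le_trans ?_ hω⟩
    rw [pow_succ, mul_assoc]
    refine Nat.mul_le_mul_left _ (le_trans (Nat.mul_le_mul_left _ (Finset.card_le_card ?_)) hω')
    intro j
    simp only [Finset.mem_filter, Finset.mem_univ, true_and, Fin.forall_fin_succ, Fin.cons_zero,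
      Fin.cons_succ]
    exact fun h => ⟨h.2, h.1⟩

end Coins

theorem existsUnique_crossPair {n : ℕ}
    (w : Fin n × (Fin n → Bool) × (Fin n → Bool) × (Fin n → Bool)) :
    ∃! i, (crossPair w).1 i > notVec (crossPair w).2 i := by
  obtain ⟨k, t, r, s⟩ := w
  refine ⟨k, by simp [crossPair, notVec], ?_⟩
  intro j hj
  by_contra h
  simp only [crossPair, notVec, andVec, Function.update_of_ne h] at hj
  revert hj
  cases t j <;> cases r j <;> cases s j <;> decide

/-- A protocol of cost at most `C` for the 2-cycle game yields `2 ^ (4 * C)`, up to a polynomial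
factor, rectangles; their number is exponential in `n`. -/
theorem RandProtocol.one_le_mul_pow_of_cost_le {n : ℕ} [NeZero n] {ε : ℝ} (hε : 0 ≤ ε)
    (hε' : ε ≤ 1 / (24 * ((4 * n : ℕ) : ℝ) ^ 3))
    (P : RandProtocol.{u} (Vertex n → Vertex n → ℝ) (Vertex n → Vertex n → ℝ)
      (Vertex n × Vertex n → ℝ))
    (hP : P.SolvesWithError (twoCycleTask n ε) (1 / 3)) {C : ℕ}
    (hC : P.cost (twoCycleTask n ε) ≤ C) {τ : ℝ} (hτ0 : 0 ≤ τ)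
    (hτ : (16 / 27) ^ n ≤ τ ^ 80) :
    1 ≤ 36 * τ * (2 ^ C * (4 * ((n : ℝ) + 1) ^ 2)) ^ 4 := by
  classical
  have hprom : ∀ w : Fin n × (Fin n → Bool) × (Fin n → Bool) × (Fin n → Bool),
      (twoCycleTask n ε).promise (utilityA (crossPair w).1)
        (utilityB (notVec (crossPair w).2)) :=
    fun w => ⟨_, _, existsUnique_crossPair w, rfl, rfl⟩
  have hbits : ∀ w (ω : P.R × P.RA × P.RB), (P.tree ω.1).bits (ω.2.1, utilityA (crossPair w).1)
      (ω.2.2, utilityB (notVec (crossPair w).2)) ≤ C := by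
    intro w ω
    have h := hC
    simp only [RandProtocol.cost, iSup_le_iff] at h
    exact_mod_cast h _ _ (hprom w) ω
  have : IsProbabilityMeasure P.coins := by
    unfold RandProtocol.coins
    infer_instance
  obtain ⟨ω, hω⟩ := exists_pow_mul_card_le P.coins
    (fun w : Fin n × (Fin n → Bool) × (Fin n → Bool) × (Fin n → Bool) =>
      {ω | ¬ P.Succeeds (twoCycleTask n ε) (utilityA (crossPair w).1)
        (utilityB (notVec (crossPair w).2)) ω})
    (fun w => hP _ _ (hprom w)) 4
  choose L inst c rej hcard hrect hdisj hrej using fun k =>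
    (P.tree (ω k).1).exists_rejecting_labelling (fun x => ((ω k).2.1, utilityA x))
      (fun z => ((ω k).2.2, utilityB (notVec z))) C hε hε'
  have hrect' : IsRectangular fun x z k => c k x z := fun x y x' y' h =>
    funext fun k => hrect k _ _ _ _ (congrFun h k)
  have hge := card_crossPair_ge hrect' (fun l => ∀ k, rej k (l k))
    (fun x z h k => hdisj k x z h) hτ0 (by simpa using hτ)
  set R := Finset.univ.filter fun w : Fin n × (Fin n → Bool) × (Fin n → Bool) × (Fin n → Bool) =>
    ∀ k, rej k (c k (crossPair w).1 (crossPair w).2)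
  have hR : 3 ^ 4 * R.card ≤ n * (2 ^ n) ^ 3 := by
    refine le_trans (Nat.mul_le_mul_left _ (Finset.card_le_card ?_)) (hω.trans_eq ?_)
    · intro w hw
      simp only [R, Finset.mem_filter, Finset.mem_univ, true_and, Set.mem_ofPred_eq] at hw ⊢
      exact fun k hs => hrej k _ _ (existsUnique_crossPair w) (hbits w (ω k)) hs (hw k)
    · simp only [Fintype.card_prod, Fintype.card_fun, Fintype.card_fin, Fintype.card_bool]
      ring
  have hR' : (81 : ℝ) * R.card ≤ n * ((2 : ℝ) ^ n) ^ 3 := by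
    have : 81 * R.card ≤ n * (2 ^ n) ^ 3 := by simpa using hR
    exact_mod_cast this
  have hL : (Fintype.card (∀ k, L k) : ℝ) ≤ (2 ^ C * (4 * ((n : ℝ) + 1) ^ 2)) ^ 4 := by
    have : Fintype.card (∀ k, L k) ≤ (2 ^ C * (4 * (n + 1) ^ 2)) ^ 4 := by
      rw [Fintype.card_pi]
      exact (Finset.prod_le_pow_card _ _ _ fun k _ => hcard k).trans_eq (by simp)
    exact_mod_cast this
  have hge' : (n : ℝ) * ((2 : ℝ) ^ n) ^ 3 * (1 - 20 * τ * Fintype.card (∀ k, L k)) ≤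
      36 * (R.card : ℝ) := by
    rw [Fintype.card_fin] at hge
    convert hge
  have hn : (0 : ℝ) < n := by exact_mod_cast NeZero.pos n
  have hnM : (0 : ℝ) < n * ((2 : ℝ) ^ n) ^ 3 := by positivity
  have h9 : n * ((2 : ℝ) ^ n) ^ 3 * (1 - 20 * τ * Fintype.card (∀ k, L k)) ≤
      n * ((2 : ℝ) ^ n) ^ 3 * (4 / 9) := by linarith
  have := le_of_mul_le_mul_left h9 hnM
  have := mul_le_mul_of_nonneg_left hL hτ0
  linarith

theorem theorem1 :
    ∃ c : ℝ, 0 < c ∧ ∃ N₀ : ℕ, ∀ (n N : ℕ) [NeZero n], 3 ≤ n → N = 4 * n → N₀ ≤ N →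
      ∀ ε : ℝ, 0 ≤ ε → ε ≤ 1 / (24 * (N : ℝ) ^ 3) →
      ∀ P : RandProtocol.{u} (Vertex n → Vertex n → ℝ) (Vertex n → Vertex n → ℝ)
          (Vertex n × Vertex n → ℝ),
        P.SolvesWithError (twoCycleTask n ε) (1 / 3) →
        ENNReal.ofReal (c * N) ≤ (P.cost (twoCycleTask n ε) : ℝ≥0∞) := by
  set s : ℝ := (16 / 27 : ℝ) ^ (1 / 160 : ℝ) with hs
  have hs0 : 0 < s := by positivity
  have hs1 : s < 1 := Real.rpow_lt_one (by norm_num) (by norm_num) (by norm_num)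
  have hs160 : s ^ 160 = 16 / 27 := by
    rw [hs, ← Real.rpow_natCast, ← Real.rpow_mul (by norm_num)]
    norm_num
  have hlim := (tendsto_pow_const_mul_const_pow_of_abs_lt_one 8
    (by rwa [abs_of_pos hs0] : |s| < 1)).const_mul (36 * (4 ^ 4 * 2 ^ 8))
  rw [mul_zero] at hlim
  obtain ⟨n₀, hn₀⟩ := Filter.eventually_atTop.1 (hlim.eventually_lt_const one_pos)
  have hlog2 : 0 < Real.log 2 := Real.log_pos (by norm_num)
  refine ⟨-Real.log s / (16 * Real.log 2),
    div_pos (neg_pos.2 (Real.log_neg hs0 hs1)) (by positivity), 4 * n₀, ?_⟩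
  rintro n _ _ hn3 rfl hN ε hε hε' P hP
  by_contra! hlt
  have hne : P.cost (twoCycleTask n ε) ≠ ⊤ := by
    intro h
    rw [h] at hlt
    simp at hlt
  obtain ⟨C, hC⟩ := ENat.ne_top_iff_exists.1 hne
  rw [← hC] at hlt
  have hCn : (C : ℝ) < -Real.log s / (16 * Real.log 2) * (4 * n : ℕ) := by
    by_contra! h
    exact hlt.not_ge (by simpa using ENNReal.ofReal_le_natCast.2 h)
  have hkey := P.one_le_mul_pow_of_cost_le hε hε' hP hC.ge (τ := s ^ (2 * n)) (by positivity)
    (by rw [← hs160, ← pow_mul, ← pow_mul]; exact le_of_eq (by congr 1; ring))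
  have hCs : (2 : ℝ) ^ (4 * C) * s ^ n ≤ 1 := by
    rw [← Real.log_nonpos_iff (by positivity), Real.log_mul (by positivity) (by positivity),
      Real.log_pow, Real.log_pow]
    rw [div_mul_eq_mul_div, lt_div_iff₀ (by positivity)] at hCn
    push_cast at hCn ⊢
    linarith
  have hn1 : (1 : ℝ) ≤ n := by exact_mod_cast (by omega : 1 ≤ n)
  have hsmall := hn₀ n (by omega)
  have : 36 * s ^ (2 * n) * (2 ^ C * (4 * ((n : ℝ) + 1) ^ 2)) ^ 4 ≤
      36 * (4 ^ 4 * 2 ^ 8) * ((n : ℝ) ^ 8 * s ^ n) := by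
    calc 36 * s ^ (2 * n) * (2 ^ C * (4 * ((n : ℝ) + 1) ^ 2)) ^ 4
        = 36 * 4 ^ 4 * (2 ^ (4 * C) * s ^ n) * (((n : ℝ) + 1) ^ 8 * s ^ n) := by ring
      _ ≤ 36 * 4 ^ 4 * 1 * ((2 * (n : ℝ)) ^ 8 * s ^ n) := by
          gcongr
          linarith
      _ = _ := by ring
  linarith
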